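/- Let $n,t,f$ be natural numbers with $n>3t$ and $f\le t$. No fairness assumption is made. **The algorithm.** There are $n$ asynchronous processes on a reliable fully connected point-to-point network; $f$ of them are Byzantine and may send arbitrary messages (in their own name), the others are correct. Each correct process proposes a binary value, which is its initial estimate $\mathit{est}$, and repeats rounds $r=r_0,r_0+1,\dots$ (only messages tagged with $r$ matter in round $r$). Round $r$: (1) bv-broadcast $\mathit{est}$, that is, send $\mathrm{EST}(\mathit{est})$ to all, from then on in this round re-send to all any value $v$ for which $\mathrm{EST}(v)$ was received from $t+1$ distinct processes (if not already sent), and add $v$ to the set $\mathit{contestants}$ whenever $\mathrm{EST}(v)$ was received from $2t+1$ distinct processes; (2) once $\mathit{contestants}\neq\emptyset$, send an $\mathrm{AUX}$ message with a nonempty set of values from $\mathit{contestants}$ to all; (3) wait until there are at least $n-t$ distinct processes from which non-empty $\mathrm{AUX}$ contents were received such that the set $\mathit{qualifiers}$ of all values received from them in $\mathrm{AUX}$ messages is contained in $\mathit{contestants}$; (4) if $\mathit{qualifiers}=\{v\}$, set $\mathit{est}:=v$ and, if $v=r\bmod 2$, decide $v$; otherwise set $\mathit{est}:=r\bmod 2$.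 **The simplified threshold automaton.** One superround $R\ge 1$ has locations $V_0,V_1,M,M_0,M_1,M_{01},E_0,E_1,D_1,V_0',V_1',M',M_0',M_1',M_{01}',D_0,E_0',E_1'$ and shared variables $\mathit{bvb}_0,\mathit{bvb}_1,a_0,a_1,\mathit{bvb}_0',\mathit{bvb}_1',a_0',a_1'$, initially $0$. Its rules are $V_v\to M$ (increment $\mathit{bvb}_v$); $M\to M_v$ if $\mathit{bvb}_v\ge1$ (increment $a_v$); $M_v\to M_{01}$ if $\mathit{bvb}_{1-v}\ge 1$; $M_0\to E_0$ and $M_{01}\to E_0$ if $a_0\ge n-t-f$; $M_1\to D_1$ and $M_{01}\to D_1$ if $a_1\ge n-t-f$; $M_{01}\to E_1$ if $a_0+a_1\ge n-t-f$; self-loops at $M,M_0,M_1,M_{01}$; $E_0\to V_0'$, $E_1\to V_1'$, $D_1\to V_1'$; and the same rules on the primed locations and variables (except the last three), with $D_0,E_0',E_1'$ in the places of $E_0,E_1,D_1$. Round-switch rules lead from $D_0$ and $E_0'$ to $V_0$, and from $E_1'$ to $V_1$, of superround $R+1$. Initially the $n-f$ correct processes are in $V_0$ or $V_1$ of superround $1$.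 At each step one process moves along a rule whose guard holds for the shared variables of its superround, or along a round-switch rule. Let $\kappa[L,R]$ be the number of processes in location $L$ of superround $R$; a process in $D_v$ decides $v$. $\mathbf F$ and $\mathbf G$ mean "at some time" and "at all times" of an infinite run. **Theorem (safety).** 1. Every infinite run of the automaton satisfies, for both $v\in\{0,1\}$: - $\mathrm{Agree}_v$: $\forall R,R'\;\bigl(\mathbf F\,\kappa[D_v,R]\ne0\Rightarrow\mathbf G\,\kappa[D_{1-v},R']=0\bigr)$; - $\mathrm{Valid}_v$: $\forall R\;\bigl(\kappa[V_v,1]=0\text{ initially}\Rightarrow\mathbf G\,\kappa[D_v,R]=0\bigr)$; - $\mathrm{Inv1}_v$: $\forall R\;\bigl(\mathbf F\,\kappa[D_v,R]\ne0\Rightarrow\mathbf G(\kappa[D_{1-v},R]=0\wedge\kappa[E'_{1-v},R]=0)\bigr)$; - $\mathrm{Inv2}_v$: $\forall R\;\bigl(\mathbf G\,\kappa[V_v,R]=0\Rightarrow\mathbf G(\kappa[D_v,R]=0\wedge\kappa[E'_v,R]=0)\bigr)$. 2. In every execution of the algorithm, with any initial round number $r_0$, no two correct processes decide different values (in the same or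 in different rounds), and a value proposed by no correct process is never decided by a correct process. -/

import Mathlib

/-! ## Multi-round threshold automata and their counter systems -/

namespace ThresholdAutomaton

/-- The parameters: number `n` of processes, upper bound `t` on the number of Byzantine processes,
actual number `f` of Byzantine processes. -/
structure Params where
  n : ℕ
  t : ℕ
  f : ℕ

/-- A guarded rule `⟨src, dst, guard ↦ update⟩` over locations `L` and shared variables `V`; the
guard is evaluated on the parameters and the shared variables, and `update x` is the number by
which the rule increments the shared variable `x`. -/
structure Rule (L V : Type) where
  src : L
  dst : L
  guard : Params → (V → ℕ) → Prop
  update : V → ℕ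

/-- A multi-round threshold automaton: the automaton of one round and the round-switch rules, which
lead (unconditionally) from a location of a round to a location of the next round. -/
structure MultiRoundTA (L V : Type) where
  initial : Finset L
  rules : List (Rule L V)
  roundSwitch : List (L × L)

/-- A configuration: `κ l R` correct processes are in location `l` of round `R`, and `g x R` is the
value of the shared variable `x` of round `R`. Rounds are numbered `1, 2, 3, …`. -/
structure Config (L V : Type) where
  κ : L → ℕ → ℕ
  g : V → ℕ → ℕ

variable {L V : Type} [DecidableEq L]

/-- Move one process along the rule `r` in round `R`. -/
def Config.applyRule (c : Config L V) (r : Rule L V) (R : ℕ) : Config L V where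
  κ l S := if S = R then
      c.κ l S - (if l = r.src then 1 else 0) + (if l = r.dst then 1 else 0)
    else c.κ l S
  g x S := if S = R then c.g x S + r.update x else c.g x S

/-- Move one process from location `a` of round `R` to location `b` of round `R + 1`. -/
def Config.applySwitch (c : Config L V) (a b : L) (R : ℕ) : Config L V where
  κ l S := c.κ l S - (if l = a ∧ S = R then 1 else 0) + (if l = b ∧ S = R + 1 then 1 else 0)
  g := c.g

/-- The transition relation of the counter system. -/
def Step (T : MultiRoundTA L V) (p : Params) (c c' : Config L V) : Prop :=
  (∃ r ∈ T.rules, ∃ R : ℕ,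
      r.guard p (fun x => c.g x R) ∧ 1 ≤ c.κ r.src R ∧ c' = c.applyRule r R) ∨
  (∃ e ∈ T.roundSwitch, ∃ R : ℕ, 1 ≤ c.κ e.1 R ∧ c' = c.applySwitch e.1 e.2 R)

/-- Initially the `n - f` correct processes are in initial locations of round `1`, and all shared
variables are `0`. -/
def IsInitial (T : MultiRoundTA L V) (p : Params) (c : Config L V) : Prop :=
  ∑ l ∈ T.initial, c.κ l 1 = p.n - p.f ∧
  (∀ l R, ¬ (l ∈ T.initial ∧ R = 1) → c.κ l R = 0) ∧
  (∀ x R, c.g x R = 0)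

/-- The infinite runs of the counter system (fully asynchronous, without fairness). -/
def IsRun (T : MultiRoundTA L V) (p : Params) (σ : ℕ → Config L V) : Prop :=
  IsInitial T p (σ 0) ∧ ∀ k, Step T p (σ k) (σ (k + 1))

/-- The temporal operator `G`, applied to a predicate on configurations. -/
def Globally (P : Config L V → Prop) (σ : ℕ → Config L V) : Prop := ∀ k, P (σ k)

/-- The temporal operator `F`, applied to a predicate on configurations. -/
def Eventually (P : Config L V → Prop) (σ : ℕ → Config L V) : Prop := ∃ k, P (σ k)

/-! ## The simplified threshold automaton of the Byzantine consensus -/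

/-- The locations of one superround; a final `x` stands for a prime. -/
inductive Loc
  | V0 | V1 | M | M0 | M1 | M01 | E0 | E1 | D1
  | V0x | V1x | Mx | M0x | M1x | M01x | D0 | E0x | E1x
  deriving DecidableEq

/-- The shared variables of one superround; a final `x` stands for a prime. -/
inductive Var
  | bvb0 | bvb1 | a0 | a1
  | bvb0x | bvb1x | a0x | a1x
  deriving DecidableEq

/-- The rules `s₁, …, s₁₁` and the four self-loops of one half of a superround, with given locations
and shared variables. `e₀`, `e`, `e₁` are the locations in which the half ends. The guard
`a ≥ n - t - f` is written `n ≤ a + t + f`. -/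
def halfRules (v₀ v₁ m m₀ m₁ m₀₁ e₀ e e₁ : Loc) (b₀ b₁ a₀ a₁ : Var) :
    List (Rule Loc Var) :=
  [ ⟨v₀, m, fun _ _ => True, Pi.single b₀ 1⟩,
    ⟨v₁, m, fun _ _ => True, Pi.single b₁ 1⟩,
    ⟨m, m₀, fun _ g => 1 ≤ g b₀, Pi.single a₀ 1⟩,
    ⟨m, m₁, fun _ g => 1 ≤ g b₁, Pi.single a₁ 1⟩,
    ⟨m₀, e₀, fun p g => p.n ≤ g a₀ + p.t + p.f, 0⟩,
    ⟨m₀, m₀₁, fun _ g => 1 ≤ g b₁, 0⟩,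
    ⟨m₁, m₀₁, fun _ g => 1 ≤ g b₀, 0⟩,
    ⟨m₁, e₁, fun p g => p.n ≤ g a₁ + p.t + p.f, 0⟩,
    ⟨m₀₁, e₀, fun p g => p.n ≤ g a₀ + p.t + p.f, 0⟩,
    ⟨m₀₁, e, fun p g => p.n ≤ g a₀ + g a₁ + p.t + p.f, 0⟩,
    ⟨m₀₁, e₁, fun p g => p.n ≤ g a₁ + p.t + p.f, 0⟩,
    ⟨m, m, fun _ _ => True, 0⟩,
    ⟨m₀, m₀, fun _ _ => True, 0⟩,
    ⟨m₁, m₁, fun _ _ => True, 0⟩,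
    ⟨m₀₁, m₀₁, fun _ _ => True, 0⟩ ]

/-- The simplified threshold automaton. Its rounds are the superrounds: superround `R` consists of
the rounds `2R - 1` (unprimed) and `2R` (primed) of the algorithm. -/
def consensusTA : MultiRoundTA Loc Var where
  initial := {.V0, .V1}
  rules :=
    halfRules .V0 .V1 .M .M0 .M1 .M01 .E0 .E1 .D1 .bvb0 .bvb1 .a0 .a1 ++
    [ ⟨.E0, .V0x, fun _ _ => True, 0⟩,
      ⟨.E1, .V1x, fun _ _ => True, 0⟩,
      ⟨.D1, .V1x, fun _ _ => True, 0⟩ ] ++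
    halfRules .V0x .V1x .Mx .M0x .M1x .M01x .D0 .E0x .E1x .bvb0x .bvb1x .a0x .a1x
  roundSwitch := [(.D0, .V0), (.E0x, .V0), (.E1x, .V1)]

/-- `V_v`; binary values are Booleans, `false` being `0` and `true` being `1`. -/
def locV (v : Bool) : Loc := if v then .V1 else .V0

/-- `D_v`: the locations in which a process decides `v`. -/
def locD (v : Bool) : Loc := if v then .D1 else .D0

/-- `E'_v`. -/
def locEx (v : Bool) : Loc := if v then .E1x else .E0x

/-- `∀ R R', F κ[D_v, R] ≠ 0 → G κ[D_{1-v}, R'] = 0`. -/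
def Agree (v : Bool) (σ : ℕ → Config Loc Var) : Prop :=
  ∀ R R' : ℕ, Eventually (fun c => c.κ (locD v) R ≠ 0) σ →
    Globally (fun c => c.κ (locD (!v)) R' = 0) σ

/-- `∀ R, κ[V_v, 1] = 0 → G κ[D_v, R] = 0`. -/
def Valid (v : Bool) (σ : ℕ → Config Loc Var) : Prop :=
  ∀ R : ℕ, (σ 0).κ (locV v) 1 = 0 → Globally (fun c => c.κ (locD v) R = 0) σ

/-- `∀ R, F κ[D_v, R] ≠ 0 → G (κ[D_{1-v}, R] = 0 ∧ κ[E'_{1-v}, R] = 0)`. -/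
def Inv1 (v : Bool) (σ : ℕ → Config Loc Var) : Prop :=
  ∀ R : ℕ, Eventually (fun c => c.κ (locD v) R ≠ 0) σ →
    Globally (fun c => c.κ (locD (!v)) R = 0 ∧ c.κ (locEx (!v)) R = 0) σ

/-- `∀ R, G κ[V_v, R] = 0 → G (κ[D_v, R] = 0 ∧ κ[E'_v, R] = 0)`. -/
def Inv2 (v : Bool) (σ : ℕ → Config Loc Var) : Prop :=
  ∀ R : ℕ, Globally (fun c => c.κ (locV v) R = 0) σ →
    Globally (fun c => c.κ (locD v) R = 0 ∧ c.κ (locEx v) R = 0) σ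

end ThresholdAutomaton

/-! ## The Byzantine consensus algorithm as a message-passing algorithm -/

namespace ByzantineConsensus

/-- Messages, tagged with a round: `EST` messages of the binary value broadcast, and `AUX` messages,
which carry a set of binary values. -/
inductive Msg
  | est (r : ℕ) (v : Bool)
  | aux (r : ℕ) (S : Finset Bool)

/-- Where a process is in the current iteration of its loop: before the invocation of
`bv-broadcast`; waiting until `contestants` is non-empty; waiting for `AUX` messages. -/
inductive Phase
  | start
  | waitContestants
  | waitFavorites

/-- The local state of a process. Variables of a round are indexed by the round. -/
structure LocalState (n : ℕ) where
  round : ℕ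
  est : Bool
  phase : Phase
  /-- `received r v`: the processes from which `EST(v)` of round `r` has been received. -/
  received : ℕ → Bool → Finset (Fin n)
  /-- `broadcasted r`: the values that the process has broadcast in `EST` messages of round `r`. -/
  broadcasted : ℕ → Finset Bool
  /-- `contestants r`: the values bv-delivered in round `r`. -/
  contestants : ℕ → Finset Bool
  /-- `favorites r j`: the values in the `AUX` messages of round `r` received from process `j`. -/
  favorites : ℕ → Fin n → Finset Bool
  /-- The values `v` for which the process has invoked `decide(v)`. -/
  decided : Finset Bool

/-- A global state: the local states, and the triples `(sender, receiver, message)` for all messages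
sent so far. -/
structure State (n : ℕ) where
  proc : Fin n → LocalState n
  sent : Set (Fin n × Fin n × Msg)

/-- Replace the local state of `i`. -/
def State.setProc {n : ℕ} (s : State n) (i : Fin n) (l : LocalState n) : State n :=
  { s with proc := Function.update s.proc i l }

/-- Process `i` sends `m` to all processes. -/
def State.broadcast {n : ℕ} (s : State n) (i : Fin n) (m : Msg) : State n :=
  { s with sent := s.sent ∪ {x | ∃ j : Fin n, x = (i, j, m)} }

/-- The values in the `AUX` messages that have been received, in round `r`, from the processes in
`Q`. -/
def LocalState.qualifiers {n : ℕ} (l : LocalState n) (r : ℕ) (Q : Finset (Fin n)) : Finset Bool :=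
  Q.biUnion (l.favorites r)

/-- The condition that ends the wait for `AUX` messages: the process has received, in the current
round, `AUX` messages from the (at least `n - t`) processes in `Q`, and it has bv-delivered all
values in them. -/
def LocalState.Qualified {n : ℕ} (t : ℕ) (l : LocalState n) (Q : Finset (Fin n)) : Prop :=
  l.phase = .waitFavorites ∧ n ≤ Q.card + t ∧ (∀ j ∈ Q, (l.favorites l.round j).Nonempty) ∧
    l.qualifiers l.round Q ⊆ l.contestants l.round

/-- The steps of the algorithm with `n` processes, of which those in `byz` are Byzantine. Byzantine
processes send arbitrary messages in their own name. A correct process receives a sent message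
(messages of past rounds are discarded, those of future rounds are kept), or executes a step of its
code in its current round. Nothing is assumed on the speed of processes or the delay of messages. -/
inductive Step {n : ℕ} (t : ℕ) (byz : Finset (Fin n)) : State n → State n → Prop
  | byzantine (s : State n) (b j : Fin n) (m : Msg) (hb : b ∈ byz) :
      Step t byz s { s with sent := insert (b, j, m) s.sent }
  | receiveEst (s : State n) (i j : Fin n) (r : ℕ) (v : Bool) (hi : i ∉ byz)
      (hm : (j, i, Msg.est r v) ∈ s.sent) (hr : (s.proc i).round ≤ r) :
      Step t byz s (s.setProc i { s.proc i with
        received := Function.update (s.proc i).received r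
          (Function.update ((s.proc i).received r) v (insert j ((s.proc i).received r v))) })
  | receiveAux (s : State n) (i j : Fin n) (r : ℕ) (S : Finset Bool) (hi : i ∉ byz)
      (hm : (j, i, Msg.aux r S) ∈ s.sent) (hr : (s.proc i).round ≤ r) :
      Step t byz s (s.setProc i { s.proc i with
        favorites := Function.update (s.proc i).favorites r
          (Function.update ((s.proc i).favorites r) j ((s.proc i).favorites r j ∪ S)) })
  /-- Start of a round: invoke `bv-broadcast` with the current estimate. -/
  | bvBroadcast (s : State n) (i : Fin n) (hi : i ∉ byz) (hp : (s.proc i).phase = .start) :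
      Step t byz s ((s.setProc i { s.proc i with
        phase := .waitContestants
        broadcasted := Function.update (s.proc i).broadcasted (s.proc i).round
          (insert (s.proc i).est ((s.proc i).broadcasted (s.proc i).round)) }).broadcast i
            (Msg.est (s.proc i).round (s.proc i).est))
  /-- `bv-broadcast`: re-broadcast a value received from `t + 1` distinct processes. -/
  | rebroadcast (s : State n) (i : Fin n) (v : Bool) (hi : i ∉ byz)
      (hp : (s.proc i).phase ≠ .start)
      (hc : t + 1 ≤ ((s.proc i).received (s.proc i).round v).card)
      (hv : v ∉ (s.proc i).broadcasted (s.proc i).round) :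
      Step t byz s ((s.setProc i { s.proc i with
        broadcasted := Function.update (s.proc i).broadcasted (s.proc i).round
          (insert v ((s.proc i).broadcasted (s.proc i).round)) }).broadcast i
            (Msg.est (s.proc i).round v))
  /-- `bv-broadcast`: deliver a value received from `2t + 1` distinct processes. -/
  | deliver (s : State n) (i : Fin n) (v : Bool) (hi : i ∉ byz)
      (hp : (s.proc i).phase ≠ .start)
      (hc : 2 * t + 1 ≤ ((s.proc i).received (s.proc i).round v).card) :
      Step t byz s (s.setProc i { s.proc i with
        contestants := Function.update (s.proc i).contestants (s.proc i).round
          (insert v ((s.proc i).contestants (s.proc i).round)) })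
  /-- Once `contestants` is non-empty, broadcast an `AUX` message with delivered values. (This
  covers both the broadcast of all values in `contestants` and that of the first one only.) -/
  | sendAux (s : State n) (i : Fin n) (S : Finset Bool) (hi : i ∉ byz)
      (hp : (s.proc i).phase = .waitContestants)
      (hne : S.Nonempty) (hS : S ⊆ (s.proc i).contestants (s.proc i).round) :
      Step t byz s ((s.setProc i { s.proc i with phase := .waitFavorites }).broadcast i
        (Msg.aux (s.proc i).round S))
  /-- End of a round if `qualifiers = {v}`: the estimate becomes `v`, and `v` is decided if it is the
  parity of the round. -/
  | finishSingleton (s : State n) (i : Fin n) (Q : Finset (Fin n)) (v : Bool) (hi : i ∉ byz)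
      (hQ : (s.proc i).Qualified t Q) (hv : (s.proc i).qualifiers (s.proc i).round Q = {v}) :
      Step t byz s (s.setProc i { s.proc i with
        est := v
        decided := if v = (s.proc i).round.bodd then insert v (s.proc i).decided
          else (s.proc i).decided
        round := (s.proc i).round + 1
        phase := .start })
  /-- End of a round otherwise: the estimate becomes the parity of the round. -/
  | finishMixed (s : State n) (i : Fin n) (Q : Finset (Fin n)) (hi : i ∉ byz)
      (hQ : (s.proc i).Qualified t Q) (hv : ∀ v, (s.proc i).qualifiers (s.proc i).round Q ≠ {v}) :
      Step t byz s (s.setProc i { s.proc i with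
        est := (s.proc i).round.bodd
        round := (s.proc i).round + 1
        phase := .start })

/-- The initial state: process `i` proposes `input i`, and the first round has number `r₀`. -/
def initState {n : ℕ} (r₀ : ℕ) (input : Fin n → Bool) : State n where
  proc i :=
    { round := r₀
      est := input i
      phase := .start
      received := fun _ _ => ∅
      broadcasted := fun _ => ∅
      contestants := fun _ => ∅
      favorites := fun _ _ => ∅
      decided := ∅ }
  sent := ∅

/-- The states that occur in executions of the algorithm. -/
def Reachable {n : ℕ} (t : ℕ) (byz : Finset (Fin n)) (r₀ : ℕ) (input : Fin n → Bool)
    (s : State n) : Prop :=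
  Relation.ReflTransGen (Step t byz) (initState r₀ input) s

end ByzantineConsensus

/-! Automaton. All guards are lower bounds on counters that never decrease, so exact times can be
dropped: it suffices to know which locations are ever visited. A visited location is traced
backwards along the rules (`IsRun.visited`, `IsRun.incremented`). Following the trace to the start
of a superround shows that `D_v` and `E'_v` are reachable only if `V_v` is, which is `Inv2`. `Inv1`
needs counting: a correct process increments only one of `a0`, `a1` in a superround, and likewise
for the primed pair, so the sum is at most n - f (`IsRun.add_le`). If both reached n - t - f, then n
≤ 2t + f ≤ 3t. Hence the exits guarded by opposite counters exclude each other. `Agree` and `Valid`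
follow by induction on superrounds: once `V_v` stays empty in one superround, it stays empty in all
later ones.

Algorithm. An execution is annotated with ghost data: the estimate with which each correct process
entered each round, and the `AUX` set it sent there. The invariant `History` says that delivered
values are estimates of correct processes in that round, and that each completed round had an
`Outcome`: a nonempty set of such values that contains the `AUX` sets of all correct members of a
quorum. Two quorums share a correct process, so two outcomes of the same round intersect
(`Outcome.inter`). If one outcome is the singleton of the parity of the round, every process
finishing that round adopts this parity, by a singleton or by default. Unanimity then persists,
because only estimates of correct processes can occur in an outcome. -/

namespace ThresholdAutomaton

/-! ### Runs of general counter systems: backward tracing -/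

section CounterSystem

variable {L V : Type} [DecidableEq L]

/-- A location that becomes non-empty in a step is entered by a proper rule or by a round switch. -/
theorem Step.entered {T : MultiRoundTA L V} {p : Params} {c c' : Config L V} (h : Step T p c c')
    {l : L} {R : ℕ} (h0 : c.κ l R = 0) (h1 : c'.κ l R ≠ 0) :
    (∃ r ∈ T.rules, r.src ≠ r.dst ∧ r.dst = l ∧ r.guard p (fun x => c.g x R) ∧
      c.κ r.src R ≠ 0) ∨
    ∃ e ∈ T.roundSwitch, ∃ S, R = S + 1 ∧ e.2 = l ∧ c.κ e.1 S ≠ 0 := by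
  rcases h with ⟨r, hr, S, hg, hs, rfl⟩ | ⟨e, he, S, hs, rfl⟩
  · left
    simp only [Config.applyRule] at h1
    split_ifs at h1 with hR hl hd hd
    all_goals first
      | omega
      | (subst hR; refine ⟨r, hr, ?_, hd.symm, hg, by omega⟩; grind)
  · right
    simp only [Config.applySwitch] at h1
    refine ⟨e, he, S, ?_⟩
    have : l = e.2 ∧ R = S + 1 := by
      by_contra hc
      rw [if_neg hc] at h1
      omega
    exact ⟨this.2, this.1.symm, by omega⟩

/-- A shared variable changes only if a rule that increments it fires. -/
theorem Step.incremented {T : MultiRoundTA L V} {p : Params} {c c' : Config L V}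
    (h : Step T p c c') {x : V} {R : ℕ} (h1 : c'.g x R ≠ c.g x R) :
    ∃ r ∈ T.rules, r.update x ≠ 0 ∧ c.κ r.src R ≠ 0 := by
  rcases h with ⟨r, hr, S, hg, hs, rfl⟩ | ⟨e, he, S, hs, rfl⟩
  · simp only [Config.applyRule] at h1
    split_ifs at h1 with hR
    · subst hR
      exact ⟨r, hr, by omega, by omega⟩
    · exact absurd rfl h1
  · exact absurd rfl h1

theorem Step.g_le {T : MultiRoundTA L V} {p : Params} {c c' : Config L V}
    (h : Step T p c c') (x : V) (R : ℕ) : c.g x R ≤ c'.g x R := by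
  rcases h with ⟨r, hr, S, hg, hs, rfl⟩ | ⟨e, he, S, hs, rfl⟩
  · simp only [Config.applyRule]
    split_ifs <;> omega
  · exact le_rfl

/-- Location `l` of round `R` is non-empty at some time. -/
def Visited (σ : ℕ → Config L V) (l : L) (R : ℕ) : Prop := ∃ k, (σ k).κ l R ≠ 0

variable {T : MultiRoundTA L V} {p : Params} {σ : ℕ → Config L V}

theorem IsRun.g_mono (h : IsRun T p σ) (x : V) (R : ℕ) : Monotone (fun k => (σ k).g x R) :=
  monotone_nat_of_le_succ fun k => (h.2 k).g_le x R

/-- The first moment at which the location is occupied is either the start or the effect of a step.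
Self-loops are excluded, since they cannot fill an empty location. Times are then forgotten, which
makes this a rule for backward reasoning. -/
theorem IsRun.visited (h : IsRun T p σ) {l : L} {R : ℕ} (hv : Visited σ l R) :
    (σ 0).κ l R ≠ 0 ∨
    (∃ r ∈ T.rules, r.src ≠ r.dst ∧ r.dst = l ∧ (∃ k, r.guard p (fun x => (σ k).g x R)) ∧
      Visited σ r.src R) ∨
    ∃ e ∈ T.roundSwitch, ∃ S, R = S + 1 ∧ e.2 = l ∧ Visited σ e.1 S := by
  obtain ⟨k, hk⟩ := hv
  induction k with
  | zero => exact Or.inl hk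
  | succ k ih =>
    by_cases h0 : (σ k).κ l R = 0
    · right
      rcases (h.2 k).entered h0 hk with ⟨r, hr, hne, hd, hg, hs⟩ | ⟨e, he, S, hR, hd, hs⟩
      · exact Or.inl ⟨r, hr, hne, hd, ⟨k, hg⟩, k, hs⟩
      · exact Or.inr ⟨e, he, S, hR, hd, k, hs⟩
    · exact ih h0

theorem IsRun.incremented (h : IsRun T p σ) {x : V} {R k : ℕ} (hk : 1 ≤ (σ k).g x R) :
    ∃ r ∈ T.rules, r.update x ≠ 0 ∧ Visited σ r.src R := by
  induction k with
  | zero => simp [h.1.2.2 x R] at hk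
  | succ k ih =>
    by_cases h0 : (σ (k + 1)).g x R = (σ k).g x R
    · exact ih (h0 ▸ hk)
    · obtain ⟨r, hr, hu, hs⟩ := (h.2 k).incremented h0
      exact ⟨r, hr, hu, k, hs⟩

/-- Superrounds start at 1 but are indexed by `ℕ`; this disposes of the spurious index 0. -/
theorem IsRun.not_visited_round_zero (h : IsRun T p σ) (l : L) : ¬ Visited σ l 0 := by
  rintro ⟨k, hk⟩
  induction k generalizing l with
  | zero => exact hk (h.1.2.1 l 0 (by simp))
  | succ k ih =>
    by_cases h0 : (σ k).κ l 0 = 0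
    · rcases (h.2 k).entered h0 hk with ⟨r, -, -, -, -, hs⟩ | ⟨e, -, S, hR, -⟩
      · exact ih _ hs
      · omega
    · exact ih l h0

/-! ### Conservation of weighted process counts -/

/-- The number of processes weighted by a function of the location and of the round `< B`. -/
def Config.weight [Fintype L] (w : L → ℕ → ℕ) (B : ℕ) (c : Config L V) : ℕ :=
  ∑ S ∈ Finset.range B, ∑ l, w l S * c.κ l S

/-- Moving one process changes the total by the difference of two weights. Both sides are written
additively to avoid truncated subtraction, and since `w` vanishes from `B` on, moves beyond the
cutoff need no separate treatment. -/
theorem Config.weight_move [Fintype L] {w : L → ℕ → ℕ} {B : ℕ} (hw : ∀ l S, B ≤ S → w l S = 0)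
    {c c' : Config L V} {a b : L} {R R' : ℕ}
    (h : ∀ l S, c'.κ l S + (if S = R then if l = a then 1 else 0 else 0) =
      c.κ l S + (if S = R' then if l = b then 1 else 0 else 0)) :
    c'.weight w B + w a R = c.weight w B + w b R' := by
  have key : ∀ (d : L) (S : ℕ), ∑ S' ∈ Finset.range B, ∑ l,
      w l S' * (if S' = S then if l = d then 1 else 0 else 0) = w d S := by
    intro d S
    rw [Finset.sum_eq_single S]
    · simp
    · intro S' _ hS'
      simp [hS']
    · intro hS
      simp [hw _ S (by simpa using hS)]
  rw [← key a R, ← key b R', weight, weight, ← Finset.sum_add_distrib, ← Finset.sum_add_distrib]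
  refine Finset.sum_congr rfl fun S _ => ?_
  rw [← Finset.sum_add_distrib, ← Finset.sum_add_distrib]
  refine Finset.sum_congr rfl fun l _ => ?_
  rw [← mul_add, ← mul_add, h]

/-- If the processes that leave the set `pre` of locations increment exactly one of `x` and `y`, then
`x + y` does not exceed the number of processes. -/
theorem IsRun.add_le [Fintype L] (h : IsRun T p σ) (pre : Finset L) (x y : V)
    (hr : ∀ r ∈ T.rules, (if r.dst ∈ pre then 1 else 0) + (r.update x + r.update y) =
      if r.src ∈ pre then 1 else 0)
    (hs : ∀ e ∈ T.roundSwitch, e.1 ∉ pre ∧ e.2 ∈ pre) (R k : ℕ) :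
    (σ k).g x R + (σ k).g y R ≤ p.n - p.f := by
  -- The weight counts the processes that have not yet left `pre` in round `R`. Each departure
  -- lowers it by one and raises `x + y` by one, so the sum of the two is conserved.
  set w : L → ℕ → ℕ := fun l S => if S < R then 1 else if S = R then (if l ∈ pre then 1 else 0) else 0
    with hwdef
  have hw : ∀ l S, R + 1 ≤ S → w l S = 0 := by
    intro l S hS
    simp only [hwdef]
    rw [if_neg (by omega), if_neg (by omega)]
  have hw1 : ∀ l S, w l S ≤ 1 := by
    intro l S
    simp only [hwdef]
    split_ifs <;> omega
  -- Only an inequality: for `R = 0` the processes, all in round 1, have weight zero.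
  have h0 : (σ 0).weight w (R + 1) ≤ p.n - p.f := by
    obtain ⟨hsum, hz, -⟩ := h.1
    rw [← hsum, Config.weight]
    calc _ ≤ ∑ S ∈ Finset.range (R + 1), if S = 1 then ∑ l ∈ T.initial, (σ 0).κ l 1 else 0 := by
          refine Finset.sum_le_sum fun S _ => ?_
          split_ifs with hS
          · subst hS
            rw [← Finset.sum_subset (Finset.subset_univ T.initial)]
            · exact Finset.sum_le_sum fun l _ => by nlinarith [hw1 l 1]
            · intro l _ hl
              rw [hz l 1 (by tauto), mul_zero]
          · refine (Finset.sum_eq_zero fun l _ => ?_).le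
            rw [hz l S (by tauto), mul_zero]
      _ ≤ _ := by
          rw [Finset.sum_ite_eq']
          split_ifs <;> simp
  suffices (σ k).weight w (R + 1) + ((σ k).g x R + (σ k).g y R) = (σ 0).weight w (R + 1) by omega
  induction k with
  | zero => simp [h.1.2.2]
  | succ k ih =>
    rw [← ih]
    rcases h.2 k with ⟨r, hrm, S, -, hS, hc⟩ | ⟨e, he, S, hS, hc⟩
    · have := Config.weight_move hw (c := σ k) (c' := σ (k + 1)) (a := r.src) (b := r.dst)
        (R := S) (R' := S) (by
          intro l S'
          rw [hc]
          simp only [Config.applyRule]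
          split_ifs <;> first | omega | (subst_vars; omega))
      have hr' := hr r hrm
      rw [hc] at this ⊢
      simp only [hwdef] at this ⊢
      simp only [Config.applyRule] at this ⊢
      rcases lt_trichotomy S R with hlt | rfl | hlt
      · rw [if_neg hlt.ne', if_neg hlt.ne']
        simp only [hlt, if_true] at this
        omega
      · simp only [lt_irrefl, if_true, if_false] at this ⊢
        omega
      · rw [if_neg hlt.ne, if_neg hlt.ne]
        simp only [hlt.not_gt, hlt.ne', if_false] at this
        omega
    · have := Config.weight_move hw (c := σ k) (c' := σ (k + 1)) (a := e.1) (b := e.2)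
        (R := S) (R' := S + 1) (by
          intro l S'
          rw [hc]
          simp only [Config.applySwitch, ite_and]
          split_ifs <;> first | omega | (subst_vars; omega))
      obtain ⟨h1, h2⟩ := hs e he
      have hg : (σ (k + 1)).g = (σ k).g := by rw [hc]; rfl
      -- The critical case is `S + 1 = R`: a process arriving in round `R` lands in `pre`, so it
      -- keeps weight 1. For `S = R` it has already left `pre`, so its weight is 0 before and after.
      have hww : w e.1 S = w e.2 (S + 1) := by
        simp only [hwdef, h1, h2, if_true, if_false]
        split_ifs <;> omega
      rw [hg]
      omega

end CounterSystem

instance : Fintype Loc where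
  elems := {.V0, .V1, .M, .M0, .M1, .M01, .E0, .E1, .D1,
    .V0x, .V1x, .Mx, .M0x, .M1x, .M01x, .D0, .E0x, .E1x}
  complete l := by cases l <;> decide

/-! ### The simplified automaton: counting and backward tracing within a superround -/

section Consensus

variable {p : Params} {σ : ℕ → Config Loc Var} {R : ℕ}

theorem IsRun.not_initial (h : IsRun consensusTA p σ) {l : Loc} (hl : l ≠ .V0 ∧ l ≠ .V1) :
    (σ 0).κ l R = 0 :=
  h.1.2.1 l R (by simp [consensusTA, hl])

theorem IsRun.a_add_le (h : IsRun consensusTA p σ) (R k : ℕ) :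
    (σ k).g .a0 R + (σ k).g .a1 R ≤ p.n - p.f := by
  refine h.add_le {.V0, .V1, .M} .a0 .a1 ?_ ?_ R k
  · simp [consensusTA, halfRules]
  · simp [consensusTA]

/-- Here `pre` takes in the whole unprimed half, so that its only exits are the two rules out of
`Mx` that increment `a0x` or `a1x`. -/
theorem IsRun.ax_add_le (h : IsRun consensusTA p σ) (R k : ℕ) :
    (σ k).g .a0x R + (σ k).g .a1x R ≤ p.n - p.f := by
  refine h.add_le {.V0, .V1, .M, .M0, .M1, .M01, .E0, .E1, .D1, .V0x, .V1x, .Mx} .a0x .a1x ?_ ?_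
    R k
  · simp [consensusTA, halfRules]
  · simp [consensusTA]

/-- Two complementary counters do not both reach the threshold. -/
theorem IsRun.not_both_high {T : MultiRoundTA Loc Var} (h : IsRun T p σ) (hn : 3 * p.t < p.n)
    (hf : p.f ≤ p.t) {x y : Var} (hle : ∀ k, (σ k).g x R + (σ k).g y R ≤ p.n - p.f)
    (hx : ∃ k, p.n ≤ (σ k).g x R + p.t + p.f) : ¬ ∃ k, p.n ≤ (σ k).g y R + p.t + p.f := by
  rintro ⟨k', hy⟩
  obtain ⟨k, hx⟩ := hx
  have h1 := hle (max k k')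
  have h2 := h.g_mono x R (le_max_left k k')
  have h3 := h.g_mono y R (le_max_right k k')
  simp only at h2 h3
  -- At the later of the two times both counters are at least n - t - f, so 2(n - t - f) ≤ n - f,
  -- contradicting n > 3t ≥ 2t + f.
  omega

theorem IsRun.visited_bvb (h : IsRun consensusTA p σ) :
    ((∃ k, 1 ≤ (σ k).g .bvb0 R) → Visited σ .V0 R) ∧
    ((∃ k, 1 ≤ (σ k).g .bvb1 R) → Visited σ .V1 R) ∧
    ((∃ k, 1 ≤ (σ k).g .bvb0x R) → Visited σ .V0x R) ∧
    ((∃ k, 1 ≤ (σ k).g .bvb1x R) → Visited σ .V1x R) := by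
  refine ⟨?_, ?_, ?_, ?_⟩ <;> rintro ⟨k, hk⟩ <;> have := h.incremented hk <;>
    simpa [consensusTA, halfRules, Pi.single_apply] using this

theorem IsRun.visited_M0 (h : IsRun consensusTA p σ) (hv : Visited σ .M0 R) : Visited σ .V0 R := by
  have := h.visited hv
  simp [consensusTA, halfRules, h.not_initial] at this
  exact h.visited_bvb.1 this.1

theorem IsRun.visited_M1 (h : IsRun consensusTA p σ) (hv : Visited σ .M1 R) : Visited σ .V1 R := by
  have := h.visited hv
  simp [consensusTA, halfRules, h.not_initial] at this
  exact h.visited_bvb.2.1 this.1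

theorem IsRun.visited_M01 (h : IsRun consensusTA p σ) (hv : Visited σ .M01 R) :
    Visited σ .V0 R ∧ Visited σ .V1 R := by
  have := h.visited hv
  simp [consensusTA, halfRules, h.not_initial] at this
  rcases this with ⟨h1, h2⟩ | ⟨h1, h2⟩
  · exact ⟨h.visited_M0 h2, h.visited_bvb.2.1 h1⟩
  · exact ⟨h.visited_bvb.1 h1, h.visited_M1 h2⟩

theorem IsRun.visited_M0x (h : IsRun consensusTA p σ) (hv : Visited σ .M0x R) :
    Visited σ .V0x R := by
  have := h.visited hv
  simp [consensusTA, halfRules, h.not_initial] at this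
  exact h.visited_bvb.2.2.1 this.1

theorem IsRun.visited_M1x (h : IsRun consensusTA p σ) (hv : Visited σ .M1x R) :
    Visited σ .V1x R := by
  have := h.visited hv
  simp [consensusTA, halfRules, h.not_initial] at this
  exact h.visited_bvb.2.2.2 this.1

theorem IsRun.visited_M01x (h : IsRun consensusTA p σ) (hv : Visited σ .M01x R) :
    Visited σ .V0x R ∧ Visited σ .V1x R := by
  have := h.visited hv
  simp [consensusTA, halfRules, h.not_initial] at this
  rcases this with ⟨h1, h2⟩ | ⟨h1, h2⟩
  · exact ⟨h.visited_M0x h2, h.visited_bvb.2.2.2 h1⟩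
  · exact ⟨h.visited_bvb.2.2.1 h1, h.visited_M1x h2⟩

theorem IsRun.visited_E0 (h : IsRun consensusTA p σ) (hv : Visited σ .E0 R) :
    Visited σ .V0 R ∧ ∃ k, p.n ≤ (σ k).g .a0 R + p.t + p.f := by
  have := h.visited hv
  simp [consensusTA, halfRules, h.not_initial] at this
  rcases this with ⟨h1, h2⟩ | ⟨h1, h2⟩
  · exact ⟨h.visited_M0 h2, h1⟩
  · exact ⟨(h.visited_M01 h2).1, h1⟩

theorem IsRun.visited_E1 (h : IsRun consensusTA p σ) (hv : Visited σ .E1 R) :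
    Visited σ .V1 R := by
  have := h.visited hv
  simp [consensusTA, halfRules, h.not_initial] at this
  exact (h.visited_M01 this.2).2

theorem IsRun.visited_D1 (h : IsRun consensusTA p σ) (hv : Visited σ .D1 R) :
    Visited σ .V1 R ∧ ∃ k, p.n ≤ (σ k).g .a1 R + p.t + p.f := by
  have := h.visited hv
  simp [consensusTA, halfRules, h.not_initial] at this
  rcases this with ⟨h1, h2⟩ | ⟨h1, h2⟩
  · exact ⟨h.visited_M1 h2, h1⟩
  · exact ⟨(h.visited_M01 h2).2, h1⟩

theorem IsRun.visited_V0x (h : IsRun consensusTA p σ) (hv : Visited σ .V0x R) :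
    Visited σ .E0 R := by
  have := h.visited hv
  simpa [consensusTA, halfRules, h.not_initial] using this

theorem IsRun.visited_V1x (h : IsRun consensusTA p σ) (hv : Visited σ .V1x R) :
    Visited σ .V1 R := by
  have := h.visited hv
  simp [consensusTA, halfRules, h.not_initial] at this
  exact this.elim h.visited_E1 fun h1 => (h.visited_D1 h1).1

theorem IsRun.visited_D0 (h : IsRun consensusTA p σ) (hv : Visited σ .D0 R) :
    Visited σ .V0x R ∧ ∃ k, p.n ≤ (σ k).g .a0x R + p.t + p.f := by
  have := h.visited hv
  simp [consensusTA, halfRules, h.not_initial] at this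
  rcases this with ⟨h1, h2⟩ | ⟨h1, h2⟩
  · exact ⟨h.visited_M0x h2, h1⟩
  · exact ⟨(h.visited_M01x h2).1, h1⟩

theorem IsRun.visited_E0x (h : IsRun consensusTA p σ) (hv : Visited σ .E0x R) :
    Visited σ .V0x R := by
  have := h.visited hv
  simp [consensusTA, halfRules, h.not_initial] at this
  exact (h.visited_M01x this.2).1

theorem IsRun.visited_E1x (h : IsRun consensusTA p σ) (hv : Visited σ .E1x R) :
    Visited σ .V1x R ∧ ∃ k, p.n ≤ (σ k).g .a1x R + p.t + p.f := by
  have := h.visited hv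
  simp [consensusTA, halfRules, h.not_initial] at this
  rcases this with ⟨h1, h2⟩ | ⟨h1, h2⟩
  · exact ⟨h.visited_M1x h2, h1⟩
  · exact ⟨(h.visited_M01x h2).2, h1⟩

/-! ### The four properties of the automaton -/

theorem globally_eq_zero_iff {l : Loc} :
    Globally (fun c => c.κ l R = 0) σ ↔ ¬ Visited σ l R := by
  simp [Globally, Visited]

theorem globally_and_eq_zero_iff {l l' : Loc} :
    Globally (fun c => c.κ l R = 0 ∧ c.κ l' R = 0) σ ↔ ¬ Visited σ l R ∧ ¬ Visited σ l' R := by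
  simp [Globally, Visited, forall_and]

theorem IsRun.visited_locV_of_locD (h : IsRun consensusTA p σ) {v : Bool}
    (hv : Visited σ (locD v) R ∨ Visited σ (locEx v) R) : Visited σ (locV v) R := by
  cases v
  · exact (h.visited_E0 (h.visited_V0x
      (hv.elim (fun h1 => (h.visited_D0 h1).1) h.visited_E0x))).1
  · exact hv.elim (fun h1 => (h.visited_D1 h1).1) fun h1 => h.visited_V1x (h.visited_E1x h1).1

theorem IsRun.inv2 (h : IsRun consensusTA p σ) (v : Bool) : Inv2 v σ := by
  intro R hR
  rw [globally_eq_zero_iff] at hR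
  rw [globally_and_eq_zero_iff]
  exact ⟨fun h1 => hR (h.visited_locV_of_locD (.inl h1)),
    fun h1 => hR (h.visited_locV_of_locD (.inr h1))⟩

theorem IsRun.inv1 (h : IsRun consensusTA p σ) (hn : 3 * p.t < p.n) (hf : p.f ≤ p.t) (v : Bool) :
    Inv1 v σ := by
  intro R hR
  change Visited σ (locD v) R at hR
  rw [globally_and_eq_zero_iff]
  -- `V0x` is fed only by `E0`, which needs `a0` high, while `D1` needs `a1` high. The remaining
  -- conflict, `D0` against `E1x`, uses the primed counters.
  have key : Visited σ .D1 R → ¬ Visited σ .V0x R := fun h1 h2 =>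
    h.not_both_high hn hf (h.a_add_le R) (h.visited_E0 (h.visited_V0x h2)).2 (h.visited_D1 h1).2
  cases v
  · exact ⟨fun h1 => key h1 (h.visited_D0 hR).1, fun h1 =>
      h.not_both_high hn hf (h.ax_add_le R) (h.visited_D0 hR).2 (h.visited_E1x h1).2⟩
  · exact ⟨fun h1 => key hR (h.visited_D0 h1).1, fun h1 => key hR (h.visited_E0x h1)⟩

/-- From superround 2 on, the initial configuration contributes nothing, so `V_v` is filled by round
switches alone. -/
theorem IsRun.visited_locV_succ (h : IsRun consensusTA p σ) {v : Bool}
    (hv : Visited σ (locV v) (R + 2)) :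
    Visited σ (locD v) (R + 1) ∨ Visited σ (locEx v) (R + 1) := by
  have h0 : ∀ l, (σ 0).κ l (R + 2) = 0 := fun l => h.1.2.1 l _ (by simp)
  have := h.visited hv
  cases v
  · simpa [consensusTA, halfRules, h0, locV, locD, locEx] using this
  · exact .inr (by simpa [consensusTA, halfRules, h0, locV, locEx] using this)

theorem IsRun.not_visited_of_le (h : IsRun consensusTA p σ) {v : Bool}
    (hv : ¬ Visited σ (locV v) (R + 1)) {R' : ℕ} (hR : R + 1 ≤ R') :
    ¬ Visited σ (locV v) R' := by
  induction R', hR using Nat.le_induction with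
  | base => exact hv
  | succ S hS ih =>
    obtain ⟨S, rfl⟩ : ∃ S', S = S' + 1 := ⟨S - 1, by omega⟩
    exact fun h1 => ih (h.visited_locV_of_locD (h.visited_locV_succ h1))

/-- By `Inv1` a decision on `v` closes both sources of the other value for the next superround, and
an empty `V` location stays empty from then on. -/
theorem IsRun.not_visited_locD_of_lt (h : IsRun consensusTA p σ) (hn : 3 * p.t < p.n)
    (hf : p.f ≤ p.t) {v : Bool} {R R' : ℕ} (hv : Visited σ (locD v) R) (hR : R < R') :
    ¬ Visited σ (locD !v) R' := by
  have h1 := globally_and_eq_zero_iff.1 (h.inv1 hn hf v R hv)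
  cases R with
  | zero => exact absurd hv (h.not_visited_round_zero _)
  | succ R =>
    have h2 : ¬ Visited σ (locV !v) (R + 2) := fun h3 => (h.visited_locV_succ h3).elim h1.1 h1.2
    exact fun h3 => h.not_visited_of_le (R := R + 1) h2 hR (h.visited_locV_of_locD (.inl h3))

theorem IsRun.agree (h : IsRun consensusTA p σ) (hn : 3 * p.t < p.n) (hf : p.f ≤ p.t) (v : Bool) :
    Agree v σ := by
  intro R R' hR
  rw [globally_eq_zero_iff]
  rcases lt_trichotomy R R' with hlt | rfl | hlt
  · exact h.not_visited_locD_of_lt hn hf hR hlt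
  · exact (globally_and_eq_zero_iff.1 (h.inv1 hn hf v R hR)).1
  · intro h1
    have := h.not_visited_locD_of_lt hn hf h1 hlt
    rw [Bool.not_not] at this
    exact this hR

theorem IsRun.valid (h : IsRun consensusTA p σ) (v : Bool) : Valid v σ := by
  intro R h0
  rw [globally_eq_zero_iff]
  have h1 : ¬ Visited σ (locV v) (0 + 1) := by
    intro hv
    have := h.visited hv
    have hz := fun l => h.not_visited_round_zero l
    cases v <;> simp_all [consensusTA, halfRules, locV]
  cases R with
  | zero => exact h.not_visited_round_zero _
  | succ R =>
    exact fun h3 => h.not_visited_of_le h1 (by omega) (h.visited_locV_of_locD (.inl h3))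

end Consensus

end ThresholdAutomaton

/-! ### The message-passing algorithm: ghost history and invariant -/

namespace ByzantineConsensus

variable {n : ℕ}

/-- Some correct process has entered round `r`, with estimate `v`. Here `ρ k` is the current round of
process `k`, and `E k r` is the estimate with which it entered round `r`. -/
def Justified (byz : Finset (Fin n)) (ρ : Fin n → ℕ) (E : Fin n → ℕ → Bool) (r : ℕ) (v : Bool) :
    Prop :=
  ∃ k, k ∉ byz ∧ r ≤ ρ k ∧ E k r = v

/-- `q` is a possible value of `qualifiers` at the end of round `r`. Here `J` tells which values are
justified, and `A j r` is the content of the `AUX` message of process `j` in round `r`. -/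
def Outcome (t : ℕ) (byz : Finset (Fin n)) (J : ℕ → Bool → Prop) (A : Fin n → ℕ → Finset Bool)
    (r : ℕ) (q : Finset Bool) : Prop :=
  q.Nonempty ∧ (∀ w ∈ q, J r w) ∧
    ∃ Q : Finset (Fin n), n ≤ Q.card + t ∧ ∀ j ∈ Q, j ∉ byz → (A j r).Nonempty ∧ A j r ⊆ q

/-- The `AUX` contents recorded in `A'` extend those recorded in `A`. -/
def AuxExtends (A A' : Fin n → ℕ → Finset Bool) : Prop := ∀ j r, A j r = ∅ ∨ A' j r = A j r

theorem Outcome.mono {t : ℕ} {byz : Finset (Fin n)} {J J' : ℕ → Bool → Prop}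
    {A A' : Fin n → ℕ → Finset Bool} (hJ : ∀ r v, J r v → J' r v) (hA : AuxExtends A A') {r : ℕ}
    {q : Finset Bool} (h : Outcome t byz J A r q) : Outcome t byz J' A' r q := by
  obtain ⟨h1, h2, Q, h3, h4⟩ := h
  refine ⟨h1, fun w hw => hJ _ _ (h2 w hw), Q, h3, fun j hj hb => ?_⟩
  obtain ⟨h5, h6⟩ := h4 j hj hb
  rw [(hA j r).resolve_left h5.ne_empty]
  exact ⟨h5, h6⟩

/-- The local part of the invariant: the state `l` of a correct process which entered round `r` with
estimate `e r` and sent `AUX` contents `a r`. -/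
structure LocalInvariant (t : ℕ) (byz : Finset (Fin n)) (r₀ : ℕ) (J : ℕ → Bool → Prop)
    (A : Fin n → ℕ → Finset Bool) (e : ℕ → Bool) (a : ℕ → Finset Bool) (l : LocalState n) :
    Prop where
  round_ge : r₀ ≤ l.round
  est_eq : e l.round = l.est
  received : ∀ r v j, j ∉ byz → j ∈ l.received r v → J r v
  contestants : ∀ r, ∀ v ∈ l.contestants r, J r v
  favorites : ∀ r j, j ∉ byz → l.favorites r j = ∅ ∨ l.favorites r j = A j r
  unsent : ∀ r, l.round < r ∨ l.round = r ∧ l.phase ≠ .waitFavorites → a r = ∅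
  finished : ∀ r, r₀ ≤ r → r < l.round → ∃ q, Outcome t byz J A r q ∧
    (q = {e (r + 1)} ∨ (∀ v, q ≠ {v}) ∧ e (r + 1) = r.bodd)
  decided : ∀ v ∈ l.decided, ∃ r, r₀ ≤ r ∧ r < l.round ∧ v = r.bodd ∧ Outcome t byz J A r {v}

/-- The process's own records `e`, `a` are kept apart from the global `J`, `A`, so that steps of
other processes affect only the latter, and only by extension. -/
theorem LocalInvariant.mono {t : ℕ} {byz : Finset (Fin n)} {r₀ : ℕ} {J J' : ℕ → Bool → Prop}
    {A A' : Fin n → ℕ → Finset Bool} {e : ℕ → Bool} {a : ℕ → Finset Bool} {l : LocalState n}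
    (hJ : ∀ r v, J r v → J' r v) (hA : AuxExtends A A')
    (h : LocalInvariant t byz r₀ J A e a l) : LocalInvariant t byz r₀ J' A' e a l where
  round_ge := h.round_ge
  est_eq := h.est_eq
  received r v j hj hm := hJ _ _ (h.received r v j hj hm)
  contestants r v hv := hJ _ _ (h.contestants r v hv)
  favorites r j hj := by
    rcases h.favorites r j hj with h1 | h1
    · exact .inl h1
    · rcases hA j r with h2 | h2
      · exact .inl (h1.trans h2)
      · exact .inr (h1.trans h2.symm)
  unsent := h.unsent
  finished r h1 h2 := by
    obtain ⟨q, h3, h4⟩ := h.finished r h1 h2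
    exact ⟨q, h3.mono hJ hA, h4⟩
  decided v hv := by
    obtain ⟨r, h1, h2, h3, h4⟩ := h.decided v hv
    exact ⟨r, h1, h2, h3, h4.mono hJ hA⟩

/-- The global invariant of the algorithm. -/
structure History (t : ℕ) (byz : Finset (Fin n)) (r₀ : ℕ) (input : Fin n → Bool)
    (E : Fin n → ℕ → Bool) (A : Fin n → ℕ → Finset Bool) (s : State n) : Prop where
  input_eq : ∀ i, i ∉ byz → E i r₀ = input i
  loc : ∀ i, i ∉ byz → LocalInvariant t byz r₀ (Justified byz (fun k => (s.proc k).round) E) A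
    (E i) (A i) (s.proc i)
  est_sent : ∀ i j r v, i ∉ byz → (i, j, Msg.est r v) ∈ s.sent →
    Justified byz (fun k => (s.proc k).round) E r v
  aux_sent : ∀ i j r S, i ∉ byz → (i, j, Msg.aux r S) ∈ s.sent →
    S.Nonempty ∧ S = A i r

/-! ### Preservation of the invariant -/

section Preservation

variable {t : ℕ} {byz : Finset (Fin n)} {r₀ : ℕ} {input : Fin n → Bool}
  {E : Fin n → ℕ → Bool} {A : Fin n → ℕ → Finset Bool} {s : State n}

theorem History.setProc (h : History t byz r₀ input E A s) {i : Fin n} (hi : i ∉ byz)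
    {l : LocalState n} (hround : l.round = (s.proc i).round)
    (hl : LocalInvariant t byz r₀ (Justified byz (fun k => (s.proc k).round) E) A (E i) (A i) l) :
    History t byz r₀ input E A (s.setProc i l) := by
  have hρ : (fun k => ((s.setProc i l).proc k).round) = fun k => (s.proc k).round := by
    funext k
    simp only [State.setProc, Function.update_apply]
    split_ifs with hk
    · rw [hk, hround]
    · rfl
  refine ⟨h.input_eq, fun k hk => ?_, ?_, h.aux_sent⟩
  · rw [hρ]
    by_cases hki : k = i
    · subst hki
      simpa [State.setProc] using hl
    · simpa [State.setProc, hki] using h.loc k hk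
  · rw [hρ]
    exact h.est_sent

theorem History.broadcast_est (h : History t byz r₀ input E A s) (i : Fin n) {r : ℕ} {v : Bool}
    (hJ : Justified byz (fun k => (s.proc k).round) E r v) :
    History t byz r₀ input E A (s.broadcast i (.est r v)) := by
  refine ⟨h.input_eq, h.loc, ?_, ?_⟩
  · rintro k j r' v' hk (hm | ⟨j', hm⟩)
    · exact h.est_sent k j r' v' hk hm
    · simp only [Prod.mk.injEq, Msg.est.injEq] at hm
      obtain ⟨-, -, rfl, rfl⟩ := hm
      exact hJ
  · rintro k j r' S hk (hm | ⟨j', hm⟩)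
    · exact h.aux_sent k j r' S hk hm
    · simp at hm

theorem History.sendAux (h : History t byz r₀ input E A s) {i : Fin n} (hi : i ∉ byz)
    {S : Finset Bool} (hS : S.Nonempty) (hp : (s.proc i).phase ≠ .waitFavorites) :
    History t byz r₀ input E
      (Function.update A i (Function.update (A i) (s.proc i).round S))
      ((s.setProc i { s.proc i with phase := .waitFavorites }).broadcast i
        (.aux (s.proc i).round S)) := by
  set A' := Function.update A i (Function.update (A i) (s.proc i).round S) with hA'
  -- A correct process sends at most one `AUX` set per round: the ghost entry is still empty, so
  -- recording `S` overwrites nothing.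
  have h0 : A i (s.proc i).round = ∅ := (h.loc i hi).unsent _ (.inr ⟨rfl, hp⟩)
  have hA : AuxExtends A A' := by
    intro j r
    by_cases hj : j = i
    · subst hj
      by_cases hr : r = (s.proc j).round
      · exact .inl (hr ▸ h0)
      · right
        simp [hA', hr]
    · right
      simp [hA', hj]
  set s' := (s.setProc i { s.proc i with phase := .waitFavorites }).broadcast i
        (.aux (s.proc i).round S) with hs'
  have hρ : (fun k => (s'.proc k).round) = fun k => (s.proc k).round := by
    funext k
    simp only [hs', State.setProc, State.broadcast, Function.update_apply]
    split_ifs with hk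
    · rw [hk]
    · rfl
  refine ⟨h.input_eq, fun k hk => ?_, ?_, ?_⟩
  · rw [hρ]
    have hk' := (h.loc k hk).mono (fun _ _ => id) hA
    by_cases hki : k = i
    · subst hki
      have hpk : s'.proc k = { s.proc k with phase := .waitFavorites } := by
        simp [hs', State.setProc, State.broadcast]
      rw [hpk]
      refine { hk' with unsent := ?_ }
      rintro r (hr | ⟨-, hr⟩)
      · simp only at hr
        simp only [hA', Function.update_self]
        rw [Function.update_of_ne hr.ne']
        exact hk'.unsent r (.inl hr)
      · exact absurd rfl hr
    · have hpk : s'.proc k = s.proc k := by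
        simp [hs', State.setProc, State.broadcast, hki]
      have hAk : A' k = A k := by simp [hA', hki]
      rw [hpk, hAk]
      exact hk'
  · rw [hρ]
    rintro k j r v hk (hm | ⟨j', hm⟩)
    · exact h.est_sent k j r v hk hm
    · simp at hm
  · rintro k j r S' hk (hm | ⟨j', hm⟩)
    · have h1 := h.aux_sent k j r S' hk hm
      rcases hA k r with h2 | h2
      · exact absurd (h1.2.trans h2) h1.1.ne_empty
      · exact ⟨h1.1, h1.2.trans h2.symm⟩
    · simp only [Prod.mk.injEq, Msg.aux.injEq] at hm
      obtain ⟨rfl, -, rfl, rfl⟩ := hm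
      exact ⟨hS, by simp [hA']⟩

theorem LocalState.Qualified.outcome {J : ℕ → Bool → Prop} {e : ℕ → Bool} {a : ℕ → Finset Bool}
    {l : LocalState n} (hl : LocalInvariant t byz r₀ J A e a l) (hn : t < n) {Q : Finset (Fin n)}
    (hQ : l.Qualified t Q) : Outcome t byz J A l.round (l.qualifiers l.round Q) := by
  obtain ⟨-, hcard, hne, hsub⟩ := hQ
  refine ⟨?_, fun w hw => hl.contestants _ w (hsub hw), Q, hcard, fun j hj hb => ?_⟩
  · obtain ⟨j, hj⟩ : Q.Nonempty := Finset.card_pos.1 (by omega)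
    obtain ⟨w, hw⟩ := hne j hj
    exact ⟨w, Finset.mem_biUnion.2 ⟨j, hj, hw⟩⟩
  · rw [← (hl.favorites l.round j hb).resolve_left (hne j hj).ne_empty]
    exact ⟨hne j hj, Finset.subset_biUnion_of_mem _ hj⟩

theorem History.finish (h : History t byz r₀ input E A s) (hn : t < n) {i : Fin n} (hi : i ∉ byz)
    {Q : Finset (Fin n)} (hQ : (s.proc i).Qualified t Q) (v : Bool) (D : Finset Bool)
    (hv : (s.proc i).qualifiers (s.proc i).round Q = {v} ∨
      (∀ w, (s.proc i).qualifiers (s.proc i).round Q ≠ {w}) ∧ v = (s.proc i).round.bodd)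
    (hD : ∀ w ∈ D, w ∈ (s.proc i).decided ∨ w = (s.proc i).round.bodd ∧
      (s.proc i).qualifiers (s.proc i).round Q = {w}) :
    History t byz r₀ input
      (Function.update E i (Function.update (E i) ((s.proc i).round + 1) v)) A
      (s.setProc i { s.proc i with
        est := v
        decided := D
        round := (s.proc i).round + 1
        phase := .start }) := by
  set E' := Function.update E i (Function.update (E i) ((s.proc i).round + 1) v) with hE'
  -- The new estimate is recorded for a round not entered before, so every earlier justification
  -- survives.
  have hE : ∀ k r, r ≤ (s.proc k).round → E' k r = E k r := by
    intro k r hr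
    by_cases hk : k = i
    · subst hk
      simp only [hE', Function.update_self]
      rw [Function.update_of_ne (by omega)]
    · simp [hE', hk]
  set s' := s.setProc i { s.proc i with
        est := v
        decided := D
        round := (s.proc i).round + 1
        phase := .start } with hs'
  have hs'i : s'.proc i = { s.proc i with
        est := v
        decided := D
        round := (s.proc i).round + 1
        phase := .start } := by
    simp [hs', State.setProc]
  have hs'k : ∀ k, k ≠ i → s'.proc k = s.proc k := by
    intro k hk
    simp [hs', State.setProc, hk]
  have hρ : ∀ k, (s.proc k).round ≤ (s'.proc k).round := by
    intro k
    by_cases hk : k = i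
    · subst hk
      rw [hs'i]
      exact Nat.le_succ _
    · rw [hs'k k hk]
  have hJ : ∀ r w, Justified byz (fun k => (s.proc k).round) E r w →
      Justified byz (fun k => (s'.proc k).round) E' r w := by
    rintro r w ⟨k, hk, hr, hw⟩
    exact ⟨k, hk, hr.trans (hρ k), (hE k r hr).trans hw⟩
  have hmono := fun k hk => (h.loc k hk).mono hJ (A' := A) fun _ _ => .inr rfl
  refine ⟨fun k hk => ?_, fun k hk => ?_, fun k j r w hk hm => hJ _ _ (h.est_sent k j r w hk hm),
    h.aux_sent⟩
  · rw [hE k r₀ (h.loc k hk).round_ge, h.input_eq k hk]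
  · have hl := hmono k hk
    by_cases hki : k = i
    · subst hki
      have hout := LocalState.Qualified.outcome hl hn hQ
      rw [hs'i]
      refine { hl with round_ge := ?_, est_eq := ?_, unsent := ?_, finished := ?_, decided := ?_ }
      · exact hl.round_ge.trans (Nat.le_succ _)
      · simp [hE']
      · rintro r hr
        refine hl.unsent r (.inl ?_)
        simp only at hr
        omega
      · intro r hr0 hr
        rcases (Nat.lt_succ_iff.1 hr).lt_or_eq with hlt | rfl
        · obtain ⟨q, h1, h2⟩ := hl.finished r hr0 hlt
          refine ⟨q, h1, ?_⟩
          rwa [hE k (r + 1) hlt]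
        · refine ⟨_, hout, ?_⟩
          simpa [hE'] using hv
      · intro w hw
        rcases hD w hw with h1 | ⟨h1, h2⟩
        · obtain ⟨r, h3, h4, h5⟩ := hl.decided w h1
          exact ⟨r, h3, h4.trans (Nat.lt_succ_self _), h5⟩
        · exact ⟨_, hl.round_ge, Nat.lt_succ_self _, h1, h2 ▸ hout⟩
    · have hEk : E' k = E k := by simp [hE', hki]
      rw [hs'k k hki, hEk]
      exact hl

/-- Among more than `t` processes there is a correct one. -/
theorem exists_correct (hb : byz.card ≤ t) {Q : Finset (Fin n)} (hQ : t < Q.card) :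
    ∃ j ∈ Q, j ∉ byz :=
  Finset.exists_mem_notMem_of_card_lt_card (hb.trans_lt hQ)

theorem History.step (hn : t < n) (hb : byz.card ≤ t) (h : History t byz r₀ input E A s)
    {s' : State n} (hs : Step t byz s s') : ∃ E' A', History t byz r₀ input E' A' s' := by
  cases hs with
  | byzantine b j m hbz =>
    refine ⟨E, A, h.input_eq, h.loc, fun k j' r v hk hm => ?_, fun k j' r S hk hm => ?_⟩
    · refine h.est_sent k j' r v hk (hm.resolve_left ?_)
      rintro ⟨⟩
      exact hk hbz
    · refine h.aux_sent k j' r S hk (hm.resolve_left ?_)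
      rintro ⟨⟩
      exact hk hbz
  | receiveEst i j r v hi hm hr =>
    refine ⟨E, A, h.setProc hi rfl { h.loc i hi with received := fun r' v' j' hj' hm' => ?_ }⟩
    by_cases hnew : r' = r ∧ v' = v ∧ j' = j
    · obtain ⟨rfl, rfl, rfl⟩ := hnew
      exact h.est_sent _ _ _ _ hj' hm
    · refine (h.loc i hi).received r' v' j' hj' ?_
      simp only [Function.update_apply] at hm'
      split_ifs at hm' with h1
      · subst h1
        simp only [Function.update_apply] at hm'
        split_ifs at hm' with h2
        · subst h2
          exact (Finset.mem_insert.1 hm').resolve_left (by tauto)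
        · exact hm'
      · exact hm'
  | receiveAux i j r S hi hm hr =>
    refine ⟨E, A, h.setProc hi rfl { h.loc i hi with favorites := fun r' j' hj' => ?_ }⟩
    have hold := (h.loc i hi).favorites r' j' hj'
    by_cases hnew : r' = r ∧ j' = j
    · obtain ⟨rfl, rfl⟩ := hnew
      right
      -- `S` is the recorded set, and the old content is empty or `S`; in both cases the union is
      -- `S`.
      rw [← (h.aux_sent _ _ _ _ hj' hm).2] at hold ⊢
      simp only [Function.update_self]
      rcases hold with h1 | h1 <;> simp [h1]
    · convert hold using 2 <;>
      · simp only [Function.update_apply]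
        split_ifs with h1
        · subst h1
          rw [Function.update_of_ne (by tauto)]
        · rfl
  | bvBroadcast i hi hp =>
    refine ⟨E, A, (h.setProc hi ?_ ?_).broadcast_est i ?_⟩
    · rfl
    · refine { h.loc i hi with unsent := fun r hr => ?_ }
      exact (h.loc i hi).unsent r (hr.imp id fun h1 => ⟨h1.1, by simp [hp]⟩)
    · refine ⟨i, hi, ?_, (h.loc i hi).est_eq⟩
      simp [State.setProc]
  | rebroadcast i v hi hp hc hv =>
    obtain ⟨j, hj, hjb⟩ := exists_correct hb (Nat.lt_of_succ_le hc)
    have h1 : History t byz r₀ input E A (s.setProc i { s.proc i with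
        broadcasted := Function.update (s.proc i).broadcasted (s.proc i).round
          (insert v ((s.proc i).broadcasted (s.proc i).round)) }) :=
      h.setProc hi rfl { h.loc i hi with }
    refine ⟨E, A, h1.broadcast_est i ((h1.loc i hi).received _ v j hjb ?_)⟩
    simpa [State.setProc] using hj
  | deliver i v hi hp hc =>
    obtain ⟨j, hj, hjb⟩ := exists_correct hb (Q := (s.proc i).received (s.proc i).round v)
      (by omega)
    refine ⟨E, A, h.setProc hi rfl { h.loc i hi with contestants := fun r w hw => ?_ }⟩
    simp only [Function.update_apply] at hw
    split_ifs at hw with h1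
    · subst h1
      rcases Finset.mem_insert.1 hw with rfl | h2
      · exact (h.loc i hi).received _ _ j hjb hj
      · exact (h.loc i hi).contestants _ w h2
    · exact (h.loc i hi).contestants _ w hw
  | sendAux i S hi hp hne hS =>
    exact ⟨_, _, h.sendAux hi hne (by simp [hp])⟩
  | finishSingleton i Q v hi hQ hv =>
    refine ⟨_, _, h.finish hn hi hQ v _ (.inl hv) fun w hw => ?_⟩
    split_ifs at hw with h1
    · rcases Finset.mem_insert.1 hw with rfl | h2
      · exact .inr ⟨h1, hv⟩
      · exact .inl h2
    · exact .inl hw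
  | finishMixed i Q hi hQ hv =>
    exact ⟨_, _, h.finish hn hi hQ _ _ (.inr ⟨hv, rfl⟩) fun w hw => .inl hw⟩

theorem Reachable.history (hn : t < n) (hb : byz.card ≤ t) (h : Reachable t byz r₀ input s) :
    ∃ E A, History t byz r₀ input E A s := by
  induction h with
  | refl =>
    -- Only the estimate at `r₀` matters here; its values at other rounds are placeholders. An empty
    -- `AUX` entry means that nothing has been sent.
    refine ⟨fun i _ => input i, fun _ _ => ∅, fun _ _ => rfl, fun i _ => ?_, ?_, ?_⟩
    · constructor <;> simp [initState]
      intro r h1 h2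
      omega
    · simp [initState]
    · simp [initState]
  | tail _ hs ih =>
    obtain ⟨E, A, h⟩ := ih
    exact h.step hn hb hs

/-! ### Agreement and validity from the invariant -/

/-- Two quorums share a correct process. -/
theorem Outcome.inter {J : ℕ → Bool → Prop} (hn : 3 * t < n) (hb : byz.card ≤ t) {r : ℕ}
    {q q' : Finset Bool} (h : Outcome t byz J A r q) (h' : Outcome t byz J A r q') :
    (q ∩ q').Nonempty := by
  obtain ⟨-, -, Q, hQ, hq⟩ := h
  obtain ⟨-, -, Q', hQ', hq'⟩ := h'
  have h1 := Finset.card_union_add_card_inter Q Q'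
  have h2 : (Q ∪ Q').card ≤ n := by simpa using Finset.card_le_univ (Q ∪ Q')
  -- The intersection has at least n - 2t > t members. The nonempty `AUX` set of a correct one lies
  -- in both outcomes.
  obtain ⟨j, hj, hjb⟩ := exists_correct hb (Q := Q ∩ Q') (by omega)
  rw [Finset.mem_inter] at hj
  obtain ⟨h3, h4⟩ := hq j hj.1 hjb
  exact h3.mono (Finset.subset_inter h4 (hq' j hj.2 hjb).2)

/-- All correct processes that have entered round `r` did so with estimate `v`. -/
def Unanimous (byz : Finset (Fin n)) (E : Fin n → ℕ → Bool) (s : State n) (r : ℕ) (v : Bool) :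
    Prop :=
  ∀ k, k ∉ byz → r ≤ (s.proc k).round → E k r = v

theorem Unanimous.outcome {r : ℕ} {v : Bool} (hu : Unanimous byz E s r v) {q : Finset Bool}
    (h : Outcome t byz (Justified byz (fun k => (s.proc k).round) E) A r q) : q = {v} := by
  refine Finset.eq_singleton_iff_nonempty_unique_mem.2 ⟨h.1, fun w hw => ?_⟩
  obtain ⟨k, hk, hr, hw⟩ := h.2.1 w hw
  exact hw ▸ hu k hk hr

/-- Under unanimity every outcome is `{v}`, so the default to the parity of the round is never
taken. -/
theorem History.unanimous_of_le (h : History t byz r₀ input E A s) {r r' : ℕ} {v : Bool}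
    (hr : r₀ ≤ r) (hrr : r ≤ r') (hu : Unanimous byz E s r v) : Unanimous byz E s r' v := by
  induction r', hrr using Nat.le_induction with
  | base => exact hu
  | succ r' hrr ih =>
    intro k hk hkr
    obtain ⟨q, hq, h1⟩ := (h.loc k hk).finished r' (hr.trans hrr) hkr
    have hqv := ih.outcome hq
    rcases h1 with h1 | h1
    · exact (Finset.singleton_injective (hqv.symm.trans h1)).symm
    · exact absurd hqv (h1.1 v)

/-- Any other outcome of the round meets `{r.bodd}`: if it is a singleton it is the same one, and
otherwise the default estimate is that very parity. -/
theorem History.unanimous_of_outcome (hn : 3 * t < n) (hb : byz.card ≤ t)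
    (h : History t byz r₀ input E A s) {r : ℕ} (hr : r₀ ≤ r)
    (ho : Outcome t byz (Justified byz (fun k => (s.proc k).round) E) A r {r.bodd}) :
    Unanimous byz E s (r + 1) r.bodd := by
  intro k hk hkr
  obtain ⟨q, hq, rfl | h1⟩ := (h.loc k hk).finished r hr hkr
  · obtain ⟨w, hw⟩ := ho.inter hn hb hq
    simp only [Finset.mem_inter, Finset.mem_singleton] at hw
    exact hw.2.symm.trans hw.1
  · exact h1.2

theorem History.agreement (hn : 3 * t < n) (hb : byz.card ≤ t)
    (h : History t byz r₀ input E A s) {i j : Fin n} (hi : i ∉ byz) (hj : j ∉ byz)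
    {v w : Bool} (hv : v ∈ (s.proc i).decided) (hw : w ∈ (s.proc j).decided) : v = w := by
  obtain ⟨r, hr, -, rfl, hro⟩ := (h.loc i hi).decided v hv
  obtain ⟨r', hr', -, rfl, hro'⟩ := (h.loc j hj).decided w hw
  rcases lt_trichotomy r r' with hlt | rfl | hlt
  · have hu := h.unanimous_of_le (by omega) hlt (h.unanimous_of_outcome hn hb hr hro)
    exact (Finset.singleton_injective (hu.outcome hro')).symm
  -- Within one round only its parity can be decided.
  · rfl
  · have hu := h.unanimous_of_le (by omega) hlt (h.unanimous_of_outcome hn hb hr' hro')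
    exact Finset.singleton_injective (hu.outcome hro)

theorem History.validity (h : History t byz r₀ input E A s) {v : Bool}
    (hv : ∀ i, i ∉ byz → input i ≠ v) {j : Fin n} (hj : j ∉ byz) : v ∉ (s.proc j).decided := by
  intro hd
  obtain ⟨r, hr, -, -, hro⟩ := (h.loc j hj).decided v hd
  -- Values are binary, so if no correct process proposes `v`, all of them start with `!v`.
  have h0 : Unanimous byz E s r₀ !v := fun k hk _ => by
    rw [h.input_eq k hk]
    exact Bool.eq_not.2 (hv k hk)
  have := Finset.singleton_injective ((h.unanimous_of_le le_rfl hr h0).outcome hro)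
  simp at this

end Preservation
end ByzantineConsensus

theorem mainTheorem2 (n t f : ℕ) (hn : 3 * t < n) (hf : f ≤ t) :
    -- the simplified threshold automaton
    (∀ σ : ℕ → ThresholdAutomaton.Config ThresholdAutomaton.Loc ThresholdAutomaton.Var,
      ThresholdAutomaton.IsRun ThresholdAutomaton.consensusTA ⟨n, t, f⟩ σ →
        ∀ v : Bool,
          ThresholdAutomaton.Agree v σ ∧ ThresholdAutomaton.Valid v σ ∧
          ThresholdAutomaton.Inv1 v σ ∧ ThresholdAutomaton.Inv2 v σ) ∧
    -- the algorithm itself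
    (∀ (byz : Finset (Fin n)), byz.card = f → ∀ (r₀ : ℕ) (input : Fin n → Bool)
      (s : ByzantineConsensus.State n), ByzantineConsensus.Reachable t byz r₀ input s →
        -- agreement
        (∀ i j : Fin n, i ∉ byz → j ∉ byz →
          ∀ v ∈ (s.proc i).decided, ∀ w ∈ (s.proc j).decided, v = w) ∧
        -- validity
        (∀ v : Bool, (∀ i : Fin n, i ∉ byz → input i ≠ v) →
          ∀ j : Fin n, j ∉ byz → v ∉ (s.proc j).decided)) := by
  refine ⟨fun σ hσ v => ⟨hσ.agree hn hf v, hσ.valid v, hσ.inv1 hn hf v, hσ.inv2 v⟩,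
    fun byz hb r₀ input s hs => ?_⟩
  obtain ⟨E, A, h⟩ := hs.history (by omega) (hb.trans_le hf)
  exact ⟨fun i j hi hj v hv w hw => h.agreement hn (hb.trans_le hf) hi hj hv hw,
    fun v hv j hj => h.validity hv hj⟩
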